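/- **Setting.** Let $(\Omega,\mathcal F,(\mathcal F_t)_{t\ge 0},\mathbb P)$ be a filtered probability space with $\mathcal F_0$ $\mathbb P$-trivial. An *impact function* is a continuous, strictly increasing $h:\mathbb R\to\mathbb R$ with $h(0)=0$ such that $x\mapsto xh(x)$ is convex. Fix an Almgren–Chriss model $(\gamma,h,P^0)$: $\gamma>0$, $h$ is an impact function, and $P^0=(P^0_t)_{t\ge0}$ is a càdlàg $(\mathcal F_t)$-martingale. Fix also $\alpha=1$, $\kappa\ge 0$, random times $0<\tau_1<\tau_2<\cdots$ and random variables $\widetilde Y_1,\widetilde Y_2,\dots$ such that $N_t:=\max\{k:\tau_k\le t\}$ (with $N_t = 0$ for $t<\tau_1$) is a Poisson process with intensity $\theta>0$, the $\widetilde Y_i$ are i.i.d. with a common law $\mu$ on $(0,\infty]$ such that $\mu([x,\infty])>0$ for all real $x>0$, and the processes $(P^0_t)$, $(N_t)$, $(\widetilde Y_i)$ are independent. Slippage is zero: $\beta=0$. **Dark-pool executions.** For an order $\widehat X\in\mathbb R$ and a minimum quantity level $\Xi\in[0,|\widehat X|]$, define recursively, with $S_i:=\sum_{j<i}|Y_j|$,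 $$Y_i:=\begin{cases}\operatorname{sgn}(\widehat X)\,\widetilde Y_i,&\widetilde Y_i\ge\Xi,\ S_i+\widetilde Y_i\le|\widehat X|,\\ \widehat X-\operatorname{sgn}(\widehat X)\,S_i,&\widetilde Y_i\ge\Xi,\ S_i+\widetilde Y_i>|\widehat X|,\\0,&\widetilde Y_i<\Xi,\end{cases}\qquad Z_t:=\sum_{i=1}^{N_t}Y_i .$$ Let $(\mathcal G_t)$ be the right-continuous filtration generated by $(\mathcal F_t)$, $Z$ and the processes $(\tau_i\wedge t)_{t\ge0}$, $i\ge1$. **Strategies.** For $X_0\in\mathbb R$ and $T>0$ let $\mathcal X(X_0,T)$ be the set of quadruples $\chi=(\widehat X,\Xi,\xi,\rho)$ with $\widehat X\in\mathbb R$, $\Xi\in[0,|\widehat X|]$, $\rho$ a $(\mathcal G_t)$-stopping time with $\rho<T$ a.s., and $\xi$ a $(\mathcal G_t)$-predictable process, a.s. integrable on $[0,T]$, whose integral $\int_0^t\xi_s\,ds$ is a.s. bounded uniformly in $t\in[0,T]$ and $\omega$, such that $X_0+\int_0^T\xi_t\,dt+Z_\rho=0$ a.s. **Costs.** Put $P^\chi_t=P^0_t+\gamma\int_0^t\xi_s\,ds+h(\xi_t)$,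 $\widehat P^\chi_{\tau_i}=P^0_{\tau_i}+\gamma\int_0^{\tau_i}\xi_s\,ds+\kappa h(\xi_{\tau_i})$, $Z^\rho_t=Z_{\rho\wedge t}$, and $$\mathcal C^\chi_T=X_0P^0_0+\int_0^T\xi_tP^\chi_t\,dt+\alpha\gamma\int_0^TZ^\rho_t\xi_t\,dt+\sum_{i=1}^{N_\rho}Y_i\Big(\widehat P^\chi_{\tau_i}+\alpha\gamma Z_{\tau_i-}+\beta(Y_i)\Big),$$ which is $+\infty$ if $\int_0^T\xi_th(\xi_t)\,dt=+\infty$. Put $\mathbb E[\mathcal C^\chi_T]:=\mathbb E[(\mathcal C^\chi_T)^+]-\mathbb E[(\mathcal C^\chi_T)^-]\in[-\infty,\infty]$, read as $+\infty$ whenever $\mathbb E[(\mathcal C^\chi_T)^+]=\infty$. **Proposition.** For every $X_0\in\mathbb R$, $$\lim_{T\uparrow\infty}\ \inf_{\chi\in\mathcal X(X_0,T)}\mathbb E[\,\mathcal C_T^\chi\,]=-\infty .$$ In particular, the model does not have nonnegative expected liquidation costs: it is not true that $\mathbb E[\mathcal C^\chi_T]\ge0$ for all $X_0\in\mathbb R$,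 $T>0$ and $\chi\in\mathcal X(X_0,T)$. -/

import Mathlib

open MeasureTheory ProbabilityTheory Filter Topology
open scoped NNReal ENNReal

namespace DarkPool

/-- Impact functions: continuous, strictly increasing, vanishing at `0`, with `x ↦ x h(x)` convex. -/
structure IsImpactFunction (h : ℝ → ℝ) : Prop where
  continuous : Continuous h
  strictMono : StrictMono h
  map_zero : h 0 = 0
  convex : ConvexOn ℝ Set.univ (fun x => x * h x)

/-- A path is càdlàg: right-continuous with (finite) left limits. -/
def IsCadlagPath (p : ℝ≥0 → ℝ) : Prop :=
  ∀ t, ContinuousWithinAt p (Set.Ici t) t ∧ ∃ l, Tendsto p (𝓝[<] t) (𝓝 l)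

/-- The data of an Almgren--Chriss model `(γ, h, P⁰)` on a filtered space, together with the data
`(α, β, κ, (τᵢ), (Ỹᵢ))` of a dark pool. Arrivals are numbered from `0`: `τ i` and `size i` are the
arrival time and the size of the `(i+1)`-st incoming matching order. Sizes may be infinite. -/
structure Model {Ω : Type*} (m : MeasurableSpace Ω) where
  /-- the underlying filtration -/
  ℱ : Filtration ℝ≥0 m
  /-- permanent impact parameter -/
  γ : ℝ
  /-- temporary impact function -/
  h : ℝ → ℝ
  /-- unaffected price process -/
  P0 : ℝ≥0 → Ω → ℝ
  /-- virtual permanent impact of dark-pool executions -/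
  α : ℝ
  /-- slippage function -/
  β : ℝ → ℝ
  /-- temporary cross-venue impact -/
  κ : ℝ
  /-- arrival times of the matching orders -/
  τ : ℕ → Ω → ℝ≥0
  /-- sizes of the matching orders -/
  size : ℕ → Ω → ℝ≥0∞
  measurable_τ : ∀ i, Measurable (τ i)
  measurable_size : ∀ i, Measurable (size i)

/-- The (signed) part of an incoming order of size `y` which is executed against a dark-pool order
of size `X` with minimum quantity level `Ξ`, when a total (unsigned) amount `S` of that order has
been executed before. -/
noncomputable def fill (X Ξ S : ℝ) (y : ℝ≥0∞) : ℝ :=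
  if ENNReal.ofReal Ξ ≤ y then
    if ENNReal.ofReal S + y ≤ ENNReal.ofReal |X| then Real.sign X * y.toReal
    else X - Real.sign X * S
  else 0

/-- The total unsigned amount `∑_{j < i} |Y_j|` that is executed against the first `i` orders. -/
noncomputable def filled (X Ξ : ℝ) (y : ℕ → ℝ≥0∞) : ℕ → ℝ
  | 0 => 0
  | i + 1 => filled X Ξ y i + |fill X Ξ (filled X Ξ y i) (y i)|

lemma measurable_fill (X Ξ : ℝ) : Measurable (fun p : ℝ × ℝ≥0∞ => fill X Ξ p.1 p.2) := by
  unfold fill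
  refine Measurable.ite (measurableSet_le measurable_const measurable_snd)
    (Measurable.ite (measurableSet_le ?_ measurable_const) ?_ ?_) measurable_const
  · exact (ENNReal.measurable_ofReal.comp measurable_fst).add measurable_snd
  · exact (ENNReal.measurable_toReal.comp measurable_snd).const_mul _
  · exact measurable_const.sub (measurable_fst.const_mul _)

namespace Model

variable {Ω : Type*} {m : MeasurableSpace Ω}

/-- The counting process `N_t` of the arrival times. -/
noncomputable def N (M : Model m) (t : ℝ≥0) (ω : Ω) : ℕ :=
  Set.ncard {i : ℕ | M.τ i ω ≤ t}

/-- `Y_i`, the part of the `i`-th incoming order that is executed in the dark pool. -/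
noncomputable def Y (M : Model m) (X Ξ : ℝ) (i : ℕ) (ω : Ω) : ℝ :=
  fill X Ξ (filled X Ξ (fun j => M.size j ω) i) (M.size i ω)

/-- `Z_t = ∑_{i ≤ N_t} Y_i`, the amount executed in the dark pool until time `t`. -/
noncomputable def Z (M : Model m) (X Ξ : ℝ) (t : ℝ≥0) (ω : Ω) : ℝ :=
  ∑ i ∈ Finset.range (M.N t ω), M.Y X Ξ i ω

lemma measurable_N (M : Model m) (t : ℝ≥0) : Measurable (M.N t) := by
  have hset : ∀ i, MeasurableSet {ω | M.τ i ω ≤ t} := fun i =>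
    measurableSet_le (M.measurable_τ i) measurable_const
  have key : ∀ ω, ((M.N t ω : ℕ) : ℝ) =
      (∑' i, ({ω | M.τ i ω ≤ t} : Set Ω).indicator (fun _ => (1 : ℝ≥0∞)) ω).toReal := by
    intro ω
    have h1 : ∑' i, ({ω | M.τ i ω ≤ t} : Set Ω).indicator (fun _ => (1 : ℝ≥0∞)) ω
        = ∑' i, ({i : ℕ | M.τ i ω ≤ t} : Set ℕ).indicator (fun _ => (1 : ℝ≥0∞)) i :=
      tsum_congr fun i => by simp [Set.indicator]
    rw [h1, ← tsum_subtype, ENNReal.tsum_set_one]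
    unfold N Set.ncard
    generalize Set.encard {i : ℕ | M.τ i ω ≤ t} = e
    induction e using ENat.recTopCoe <;> simp
  have hR : Measurable (fun ω => ((M.N t ω : ℕ) : ℝ)) := by
    simp_rw [key]
    exact (Measurable.tsum fun i =>
      measurable_const.indicator (hset i)).ennreal_toReal
  refine measurable_to_countable' fun n => ?_
  have : M.N t ⁻¹' {n} = (fun ω => ((M.N t ω : ℕ) : ℝ)) ⁻¹' {(n : ℝ)} := by
    ext ω; simp
  rw [this]
  exact hR (measurableSet_singleton _)

lemma measurable_filled (M : Model m) (X Ξ : ℝ) (i : ℕ) :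
    Measurable (fun ω => filled X Ξ (fun j => M.size j ω) i) := by
  induction i with
  | zero => exact measurable_const
  | succ i ih =>
    have := (measurable_fill X Ξ).comp (ih.prodMk (M.measurable_size i))
    exact ih.add (measurable_norm.comp this)

lemma measurable_Y (M : Model m) (X Ξ : ℝ) (i : ℕ) : Measurable (M.Y X Ξ i) :=
  (measurable_fill X Ξ).comp ((M.measurable_filled X Ξ i).prodMk (M.measurable_size i))

lemma measurable_Z (M : Model m) (X Ξ : ℝ) (t : ℝ≥0) : Measurable (M.Z X Ξ t) := by
  have h : Measurable (fun p : ℕ × Ω => ∑ i ∈ Finset.range p.1, M.Y X Ξ i p.2) :=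
    measurable_from_prod_countable_right fun n =>
      Finset.measurable_sum (Finset.range n) fun i _ => M.measurable_Y X Ξ i
  exact h.comp ((M.measurable_N t).prodMk measurable_id)

/-- `(𝒢_t)`: the right-continuous filtration generated by `(ℱ_t)`, by `Z` and by the processes
`(τᵢ ∧ t)_{t ≥ 0}`. Through `Z` it depends on the dark-pool order `X` and on its level `Ξ`. -/
noncomputable def 𝒢 (M : Model m) (X Ξ : ℝ) : Filtration ℝ≥0 m :=
  (M.ℱ
    ⊔ Filtration.natural (M.Z X Ξ) (fun t => (M.measurable_Z X Ξ t).stronglyMeasurable)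
    ⊔ ⨆ i, Filtration.natural (fun t ω => min (M.τ i ω) t)
        (fun _ => ((M.measurable_τ i).min measurable_const).stronglyMeasurable)).rightCont

/-- The standing assumptions on the Almgren--Chriss model `(γ, h, P⁰)`. -/
structure IsAlmgrenChriss (M : Model m) (P : Measure Ω) : Prop where
  γ_pos : 0 < M.γ
  impact : IsImpactFunction M.h
  martingale : Martingale M.P0 M.ℱ P
  cadlag : ∀ ω, IsCadlagPath (fun t => M.P0 t ω)
  trivial_zero : ∀ A, MeasurableSet[M.ℱ 0] A → P A = 0 ∨ P A = 1

/-- `N` is a Poisson process with intensity `θ`. -/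
structure IsPoissonProcess (N : ℝ≥0 → Ω → ℕ) (θ : ℝ≥0) (P : Measure Ω) : Prop where
  zero : ∀ᵐ ω ∂P, N 0 ω = 0
  indep : HasIndepIncrements (fun t ω => (N t ω : ℤ)) P
  law : ∀ s t : ℝ≥0, s ≤ t →
    HasLaw (fun ω => (N t ω : ℤ) - N s ω)
      ((poissonMeasure (θ * (t - s))).map (Nat.cast : ℕ → ℤ)) P

/-- The standing assumptions on a dark pool without slippage, with Poisson arrivals of intensity
`θ > 0` and with i.i.d. sizes in `(0, ∞]`, unbounded from above, such that prices, arrivals and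
sizes are independent. -/
structure IsPoissonDarkPool (M : Model m) (θ : ℝ≥0) (P : Measure Ω) : Prop where
  κ_nonneg : 0 ≤ M.κ
  no_slippage : ∀ y, M.β y = 0
  θ_pos : 0 < θ
  τ_pos : ∀ᵐ ω ∂P, 0 < M.τ 0 ω
  τ_strictMono : ∀ᵐ ω ∂P, StrictMono (fun i => M.τ i ω)
  poisson : IsPoissonProcess M.N θ P
  size_iIndep : iIndepFun M.size P
  size_identDistrib : ∀ i, IdentDistrib (M.size i) (M.size 0) P P
  size_pos : ∀ᵐ ω ∂P, 0 < M.size 0 ω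
  size_unbounded : ∀ x : ℝ≥0, 0 < P {ω | (x : ℝ≥0∞) ≤ M.size 0 ω}
  independent : iIndep
    ![⨆ t, MeasurableSpace.comap (M.P0 t) inferInstance,
      ⨆ t, MeasurableSpace.comap (M.N t) inferInstance,
      ⨆ i, MeasurableSpace.comap (M.size i) inferInstance] P

end Model

/-- The components `(X̂, Ξ, ξ, ρ)` of a trading strategy: dark-pool order, minimum quantity level,
trading speed at the exchange, cancellation time. -/
structure Strategy (Ω : Type*) where
  X : ℝ
  Ξ : ℝ
  ξ : ℝ≥0 → Ω → ℝ
  ρ : Ω → ℝ≥0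

/-- `∫₀ᵗ ξ_s ds` -/
noncomputable def Strategy.traded {Ω : Type*} (χ : Strategy Ω) (t : ℝ≥0) (ω : Ω) : ℝ :=
  ∫ s in (0 : ℝ)..t, χ.ξ s.toNNReal ω

namespace Model

variable {Ω : Type*} {m : MeasurableSpace Ω}

/-- Admissibility of a strategy for the initial position `X₀` and the liquidation horizon `T`. -/
structure IsAdmissible (M : Model m) (P : Measure Ω) (X₀ : ℝ) (T : ℝ≥0) (χ : Strategy Ω) :
    Prop where
  level : χ.Ξ ∈ Set.Icc 0 |χ.X|
  stopping : IsStoppingTime (M.𝒢 χ.X χ.Ξ) (fun ω => (χ.ρ ω : WithTop ℝ≥0))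
  ρ_lt : ∀ᵐ ω ∂P, χ.ρ ω < T
  predictable : IsStronglyPredictable (M.𝒢 χ.X χ.Ξ) χ.ξ
  integrable : ∀ᵐ ω ∂P, IntervalIntegrable (fun s : ℝ => χ.ξ s.toNNReal ω) volume 0 T
  bounded : ∃ K : ℝ, ∀ᵐ ω ∂P, ∀ t ≤ T, |χ.traded t ω| ≤ K
  liquidation : ∀ᵐ ω ∂P, X₀ + χ.traded T ω + M.Z χ.X χ.Ξ (χ.ρ ω) ω = 0

/-- The set `𝒳(X₀, T)` of admissible strategies. -/
def admissible (M : Model m) (P : Measure Ω) (X₀ : ℝ) (T : ℝ≥0) : Set (Strategy Ω) :=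
  {χ | M.IsAdmissible P X₀ T χ}

/-- The price `P^χ_t = P⁰_t + γ ∫₀ᵗ ξ_s ds + h(ξ_t)` at the exchange. -/
noncomputable def price (M : Model m) (χ : Strategy Ω) (t : ℝ≥0) (ω : Ω) : ℝ :=
  M.P0 t ω + M.γ * χ.traded t ω + M.h (χ.ξ t ω)

/-- The price `P⁰_t + γ ∫₀ᵗ ξ_s ds + κ h(ξ_t)` of an execution in the dark pool at time `t`. -/
noncomputable def darkPrice (M : Model m) (χ : Strategy Ω) (t : ℝ≥0) (ω : Ω) : ℝ :=
  M.P0 t ω + M.γ * χ.traded t ω + M.κ * M.h (χ.ξ t ω)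

open scoped Classical in
/-- The costs `C_T^χ` on the horizon `[0, T]`. For an admissible strategy only the non-negative part
`ξ_t h(ξ_t)` of `ξ_t P^χ_t` can fail to be integrable on `[0, T]`; in this case `∫₀ᵀ ξ_t P^χ_t dt`,
and with it the costs, equal `+∞`. -/
noncomputable def costs (M : Model m) (X₀ : ℝ) (T : ℝ≥0) (χ : Strategy Ω) (ω : Ω) : EReal :=
  if IntervalIntegrable (fun t : ℝ => χ.ξ t.toNNReal ω * M.price χ t.toNNReal ω) volume 0 T then
    ((X₀ * M.P0 0 ω
      + (∫ t in (0 : ℝ)..T, χ.ξ t.toNNReal ω * M.price χ t.toNNReal ω)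
      + M.α * M.γ *
        (∫ t in (0 : ℝ)..T, M.Z χ.X χ.Ξ (min (χ.ρ ω) t.toNNReal) ω * χ.ξ t.toNNReal ω)
      + ∑ i ∈ Finset.range (M.N (χ.ρ ω) ω), M.Y χ.X χ.Ξ i ω *
          (M.darkPrice χ (M.τ i ω) ω
            + M.α * M.γ * Function.leftLim (fun t => M.Z χ.X χ.Ξ t ω) (M.τ i ω)
            + M.β (M.Y χ.X χ.Ξ i ω)) : ℝ) : EReal)
  else ⊤

end Model

open scoped Classical in
/-- The expectation `E[C⁺] - E[C⁻]` of an extended random variable, with the convention that it is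
`+∞` whenever `E[C⁺] = ∞`. -/
noncomputable def expectation {Ω : Type*} {m : MeasurableSpace Ω} (P : Measure Ω)
    (C : Ω → EReal) : EReal :=
  if ∫⁻ ω, (C ω).toENNReal ∂P = ⊤ then ⊤
  else ((∫⁻ ω, (C ω).toENNReal ∂P : ℝ≥0∞) : EReal) - ((∫⁻ ω, (-C ω).toENNReal ∂P : ℝ≥0∞) : EReal)

/-- The model has nonnegative expected liquidation costs. -/
def Model.NonnegativeExpectedLiquidationCosts {Ω : Type*} {m : MeasurableSpace Ω}
    (M : Model m) (P : Measure Ω) : Prop :=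
  ∀ (X₀ : ℝ) (T : ℝ≥0), 0 < T → ∀ χ ∈ M.admissible P X₀ T,
    0 ≤ expectation P (M.costs X₀ T χ)

end DarkPool

/-! A position can be pumped up in the dark pool without moving the price and then unwound slowly at
the exchange. Place a dark-pool order of size `x` whose minimum quantity is also `x`, do not trade
until time `S`, cancel, and liquidate what is held at constant speed on `(S, 2S]`. The order is
filled all or nothing, so `Z_S` is either `0` or `x` (`Z_self`), and any fill happens at the
unaffected price with no earlier execution (`RegularArrivals.sum_Y_mul`).

In the costs, permanent impact contributes `γ/2 (X₀ + Z_S)²` from the exchange and `-γ Z_S (X₀ +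
Z_S)` from the virtual impact of the fill (here `α = 1`), together `γ/2 (X₀² - Z_S²)`. The
unaffected price enters with total weight `X₀ - (X₀ + Z_S) + Z_S = 0`. Since arrivals and sizes are
independent of the martingale `P⁰`, evaluating or averaging it with such weights only produces its
mean (`integral_mul_P0`, `integral_mul_intervalIntegral_P0`), so these terms cancel in expectation.
Temporary impact is negligible because the speed is of order `1/S` and `h` is continuous with `h 0 =
0`.

As `S → ∞` the order is almost surely filled, so `E[Z_S²] → x²` (`tendsto_integral_Z_sq`). The
expected costs are then at most about `γ/2 (X₀² - x²) + 1`, and `x` is arbitrary. -/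

namespace DarkPool

/-! ### Orders whose minimum quantity equals their size -/

section Fill

variable {x : ℝ}

lemma fill_self_zero (hx : 0 < x) (y : ℝ≥0∞) :
    fill x x 0 y = if ENNReal.ofReal x ≤ y then x else 0 := by
  unfold fill
  split_ifs with h1 h2
  · have : y = ENNReal.ofReal x := le_antisymm (by simpa [abs_of_pos hx] using h2) h1
    simp [this, Real.sign_of_pos hx, hx.le]
  · simp
  · rfl

/-- After a complete fill, a further eligible order leaves only the remainder `x - x`; the other
branch would need `x + x ≤ x`. -/
lemma fill_self_self (hx : 0 < x) (y : ℝ≥0∞) : fill x x x y = 0 := by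
  unfold fill
  split_ifs with h1 h2
  · exfalso
    rw [abs_of_pos hx] at h2
    have h3 : ENNReal.ofReal x + ENNReal.ofReal x ≤ ENNReal.ofReal x := by
      refine le_trans ?_ h2
      gcongr
    rw [← ENNReal.ofReal_add hx.le hx.le, ENNReal.ofReal_le_ofReal_iff hx.le] at h3
    linarith
  · simp [Real.sign_of_pos hx]
  · rfl

open scoped Classical in
/-- An order whose minimum quantity equals its size is executed completely by the first incoming
order which is large enough. -/
lemma filled_self (hx : 0 < x) (y : ℕ → ℝ≥0∞) (n : ℕ) :
    filled x x y n = if ∃ i < n, ENNReal.ofReal x ≤ y i then x else 0 := by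
  induction n with
  | zero => simp [filled]
  | succ n ih =>
    rw [filled, ih]
    by_cases h : ∃ i < n, ENNReal.ofReal x ≤ y i
    · have h' : ∃ i < n + 1, ENNReal.ofReal x ≤ y i := by
        obtain ⟨i, hi, h⟩ := h
        exact ⟨i, by omega, h⟩
      rw [if_pos h, if_pos h', fill_self_self hx]
      simp
    · rw [if_neg h, fill_self_zero hx]
      by_cases hn : ENNReal.ofReal x ≤ y n
      · rw [if_pos hn, if_pos ⟨n, by omega, hn⟩, abs_of_pos hx, zero_add]
      · have h' : ¬ ∃ i < n + 1, ENNReal.ofReal x ≤ y i := by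
          rintro ⟨i, hi, hi'⟩
          rcases Nat.lt_succ_iff_lt_or_eq.1 hi with h2 | rfl
          · exact h ⟨i, h2, hi'⟩
          · exact hn hi'
        rw [if_neg hn, if_neg h']
        simp

lemma fill_filled_ne_zero (hx : 0 < x) {y : ℕ → ℝ≥0∞} {i : ℕ}
    (h : fill x x (filled x x y i) (y i) ≠ 0) :
    ENNReal.ofReal x ≤ y i ∧ ∀ j < i, ¬ ENNReal.ofReal x ≤ y j := by
  classical
  rw [filled_self hx] at h
  split_ifs at h with h1
  · exact absurd (fill_self_self hx _) h
  · rw [fill_self_zero hx] at h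
    refine ⟨by_contra fun h2 => h (if_neg h2), fun j hj hj' => h1 ⟨j, hj, hj'⟩⟩

/-- For a buy order all executions are nonnegative, so the signed sum defining `Z` agrees with the
unsigned one. -/
lemma sum_fill (hx : 0 < x) (y : ℕ → ℝ≥0∞) (n : ℕ) :
    ∑ i ∈ Finset.range n, fill x x (filled x x y i) (y i) = filled x x y n := by
  classical
  induction n with
  | zero => simp [filled]
  | succ n ih =>
    rw [Finset.sum_range_succ, ih, filled]
    congr 1
    symm
    apply abs_of_nonneg
    rw [filled_self hx]
    split_ifs
    · rw [fill_self_self hx]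
    · rw [fill_self_zero hx]
      split_ifs <;> linarith

end Fill

/-! ### The event and the time of complete execution -/

namespace Model

variable {Ω : Type*} {m : MeasurableSpace Ω} (M : Model m)

/-- The event that one of the orders arriving until time `t` has at least the size `x`. -/
def hit (x : ℝ) (t : ℝ≥0) : Set Ω :=
  {ω | ∃ i < M.N t ω, ENNReal.ofReal x ≤ M.size i ω}

lemma Z_self {x : ℝ} (hx : 0 < x) (t : ℝ≥0) :
    M.Z x x t = (M.hit x t).indicator (fun _ => x) := by
  classical
  funext ω
  simp only [Z, Y]
  rw [sum_fill hx (fun j => M.size j ω), filled_self hx, Set.indicator_apply]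
  split_ifs with h1 h2 h2
  exacts [rfl, absurd h1 h2, absurd h2 h1, rfl]

/-- The arrival times of the scenario `ω` are positive, increasing and do not accumulate. -/
structure RegularArrivals (ω : Ω) : Prop where
  pos : 0 < M.τ 0 ω
  strictMono : StrictMono (fun i => M.τ i ω)
  finite : ∀ t, {i : ℕ | M.τ i ω ≤ t}.Finite

variable {M} {ω : Ω}

/-- The indices of arrivals up to `t` form an initial segment of `ℕ`. Finiteness matters because
`ncard` is `0` on infinite sets. -/
lemma RegularArrivals.lt_N_iff (hω : M.RegularArrivals ω) {i : ℕ} {t : ℝ≥0} :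
    i < M.N t ω ↔ M.τ i ω ≤ t := by
  unfold N
  constructor
  · intro h
    by_contra h2
    have hsub : {i : ℕ | M.τ i ω ≤ t} ⊆ Set.Iio i := fun j hj => by
      by_contra h3
      exact h2 ((hω.strictMono.monotone (not_lt.1 h3)).trans hj)
    have := Set.ncard_le_ncard hsub (Set.finite_Iio i)
    rw [← Finset.coe_Iio, Set.ncard_coe_finset, Nat.card_Iio] at this
    omega
  · intro h
    have hsub : Set.Iic i ⊆ {i : ℕ | M.τ i ω ≤ t} := fun j hj =>
      (hω.strictMono.monotone hj).trans h
    have := Set.ncard_le_ncard hsub (hω.finite t)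
    rw [← Finset.coe_Iic, Set.ncard_coe_finset, Nat.card_Iic] at this
    omega

lemma RegularArrivals.mem_hit_iff (hω : M.RegularArrivals ω) {x : ℝ} {t : ℝ≥0} :
    ω ∈ M.hit x t ↔ ∃ i, M.τ i ω ≤ t ∧ ENNReal.ofReal x ≤ M.size i ω := by
  simp [hit, hω.lt_N_iff]

/-- Only the first sufficiently large order is executed, and before its arrival nothing is. -/
lemma RegularArrivals.mem_hit_iff_of_Y_ne_zero (hω : M.RegularArrivals ω) {x : ℝ} (hx : 0 < x)
    {i : ℕ} (hY : M.Y x x i ω ≠ 0) {t : ℝ≥0} : ω ∈ M.hit x t ↔ M.τ i ω ≤ t := by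
  obtain ⟨h1, h2⟩ := fill_filled_ne_zero (y := fun j => M.size j ω) hx hY
  rw [hω.mem_hit_iff]
  refine ⟨?_, fun h => ⟨i, h, h1⟩⟩
  rintro ⟨j, hj, hj'⟩
  have : i ≤ j := by
    by_contra h
    exact h2 j (not_le.1 h) hj'
  exact (hω.strictMono.monotone this).trans hj

lemma RegularArrivals.leftLim_Z (hω : M.RegularArrivals ω) {x : ℝ} (hx : 0 < x)
    {i : ℕ} (hY : M.Y x x i ω ≠ 0) :
    Function.leftLim (fun t => M.Z x x t ω) (M.τ i ω) = 0 := by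
  have hpos : 0 < M.τ i ω := hω.pos.trans_le (hω.strictMono.monotone (Nat.zero_le i))
  -- At time `0` there is nothing to the left, and `leftLim` would return the value of the function
  -- itself.
  have : (𝓝[<] M.τ i ω).NeBot := nhdsLT_neBot_of_exists_lt ⟨0, hpos⟩
  refine leftLim_eq_of_tendsto (tendsto_const_nhds.congr' ?_)
  filter_upwards [self_mem_nhdsWithin] with t ht
  rw [M.Z_self hx, Set.indicator_of_notMem]
  rw [hω.mem_hit_iff_of_Y_ne_zero hx hY]
  exact not_le.2 ht

/-- The first time of a complete execution of an order of size `x`, capped at `S`. -/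
noncomputable def hitTime (M : Model m) (x : ℝ) (S : ℝ≥0) (ω : Ω) : ℝ≥0 :=
  min S (⨅ n : ℕ, (M.hit x (TopologicalSpace.denseSeq ℝ≥0 n)).indicator
    (fun _ => TopologicalSpace.denseSeq ℝ≥0 n) ω +
      (M.hit x (TopologicalSpace.denseSeq ℝ≥0 n))ᶜ.indicator (fun _ => S) ω)

lemma RegularArrivals.hitTime_eq (hω : M.RegularArrivals ω) {x : ℝ} (hx : 0 < x)
    {i : ℕ} (hY : M.Y x x i ω ≠ 0) {S : ℝ≥0} (hS : M.τ i ω ≤ S) :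
    M.hitTime x S ω = M.τ i ω := by
  apply le_antisymm
  · refine le_of_forall_gt fun b hb => ?_
    obtain ⟨_, ⟨n, rfl⟩, h1, h2⟩ :=
      (TopologicalSpace.denseRange_denseSeq ℝ≥0).exists_between hb
    refine lt_of_le_of_lt ((min_le_right _ _).trans (ciInf_le' _ n)) ?_
    have : ω ∈ M.hit x (TopologicalSpace.denseSeq ℝ≥0 n) :=
      (hω.mem_hit_iff_of_Y_ne_zero hx hY).2 h1.le
    simpa [this] using h2
  · refine le_min hS (le_ciInf fun n => ?_)
    by_cases h : ω ∈ M.hit x (TopologicalSpace.denseSeq ℝ≥0 n)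
    · simpa [h] using (hω.mem_hit_iff_of_Y_ne_zero hx hY).1 h
    · simpa [h] using hS

end Model

end DarkPool

/-! ### Evaluation of processes at independent random times -/

namespace DarkPool

variable {Ω : Type*} {m : MeasurableSpace Ω} {P : Measure Ω}

lemma expectation_eq_integral {C : Ω → EReal} {c : Ω → ℝ} (hC : ∀ᵐ ω ∂P, C ω = c ω)
    (hc : Integrable c P) : expectation P C = ((∫ ω, c ω ∂P : ℝ) : EReal) := by
  have h1 : ∫⁻ ω, (C ω).toENNReal ∂P = ∫⁻ ω, ENNReal.ofReal (c ω) ∂P :=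
    lintegral_congr_ae (hC.mono fun ω h => by
      simp [h, EReal.toENNReal_of_ne_top])
  have h2 : ∫⁻ ω, (-C ω).toENNReal ∂P = ∫⁻ ω, ENNReal.ofReal (-c ω) ∂P :=
    lintegral_congr_ae (hC.mono fun ω h => by
      simp only [h]
      rw [← EReal.coe_neg, EReal.toENNReal_of_ne_top (EReal.coe_ne_top _), EReal.toReal_coe])
  have h3 : ∫⁻ ω, ENNReal.ofReal (c ω) ∂P ≠ ⊤ := hc.lintegral_lt_top.ne
  have h4 : ∫⁻ ω, ENNReal.ofReal (-c ω) ∂P ≠ ⊤ := hc.neg.lintegral_lt_top.ne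
  unfold expectation
  rw [h1, h2, if_neg h3, integral_eq_lintegral_pos_part_sub_lintegral_neg_part hc,
    EReal.coe_sub, EReal.coe_ennreal_toReal h3, EReal.coe_ennreal_toReal h4]

/-- Evaluation of a process at an independent bounded random time, with an independent weight. -/
lemma integral_mul_eval_of_indepFun [IsProbabilityMeasure P] {α : Type*} [MeasurableSpace α]
    {g : Ω → α} (hg : Measurable g) {Q : ℝ≥0 → α → ℝ} (hQ : Measurable (Function.uncurry Q))
    {T : ℝ≥0} {K B c : ℝ} (hint : ∀ t ≤ T, Integrable (fun ω => Q t (g ω)) P)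
    (hK : ∀ t ≤ T, ∫ ω, |Q t (g ω)| ∂P ≤ K) (hc : ∀ t ≤ T, ∫ ω, Q t (g ω) ∂P = c)
    {σ : Ω → ℝ≥0} {w : Ω → ℝ} (hσm : Measurable σ) (hwm : Measurable w)
    (hσ : ∀ ω, σ ω ≤ T) (hw : ∀ ω, |w ω| ≤ B)
    (hind : IndepFun (fun ω => (σ ω, w ω)) g P) :
    Integrable (fun ω => w ω * Q (σ ω) (g ω)) P ∧
      ∫ ω, w ω * Q (σ ω) (g ω) ∂P = c * ∫ ω, w ω ∂P := by
  have hf : Measurable (fun ω => (σ ω, w ω)) := hσm.prodMk hwm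
  have hfg : Measurable (fun ω => ((σ ω, w ω), g ω)) := hf.prodMk hg
  have hmap := hind.map_prod_eq_prod_map_map hf.aemeasurable hg.aemeasurable
  have : IsProbabilityMeasure (P.map (fun ω => (σ ω, w ω))) :=
    Measure.isProbabilityMeasure_map hf.aemeasurable
  have : IsProbabilityMeasure (P.map g) := Measure.isProbabilityMeasure_map hg.aemeasurable
  have hQt : ∀ t, Measurable (Q t) := fun t => hQ.comp measurable_prodMk_left
  let G : (ℝ≥0 × ℝ) × α → ℝ := fun p => p.1.2 * Q p.1.1 p.2
  have hG : Measurable G :=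
    measurable_fst.snd.mul (hQ.comp (measurable_fst.fst.prodMk measurable_snd))
  have hae : ∀ᵐ p ∂(P.map (fun ω => (σ ω, w ω))), p.1 ≤ T ∧ |p.2| ≤ B := by
    rw [ae_map_iff hf.aemeasurable]
    · exact Eventually.of_forall fun ω => ⟨hσ ω, hw ω⟩
    · exact (measurableSet_le measurable_fst measurable_const).inter
        (measurableSet_le (measurable_norm.comp measurable_snd) measurable_const)
  have hB : 0 ≤ B := by
    obtain ⟨ω⟩ := nonempty_of_isProbabilityMeasure P
    exact (abs_nonneg _).trans (hw ω)
  have hQint : ∀ t ≤ T, Integrable (Q t) (P.map g) := fun t ht =>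
    (integrable_map_measure (hQt t).aestronglyMeasurable hg.aemeasurable).2 (hint t ht)
  -- By independence the joint law is a product. The uniform `L¹` bound `K` gives integrability on
  -- it, and Fubini then permits freezing `(σ, w)` first.
  have hGint : Integrable G ((P.map (fun ω => (σ ω, w ω))).prod (P.map g)) := by
    rw [integrable_prod_iff hG.aestronglyMeasurable]
    refine ⟨hae.mono fun p hp => by
      simpa only [G] using (hQint p.1 hp.1).const_mul p.2, ?_⟩
    refine Integrable.of_bound (C := B * K)
      hG.aestronglyMeasurable.norm.integral_prod_right' (hae.mono fun p hp => ?_)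
    have h1 : ∫ a, ‖G (p, a)‖ ∂(P.map g) = |p.2| * ∫ ω, |Q p.1 (g ω)| ∂P := by
      rw [← integral_map (f := fun a => |Q p.1 a|) hg.aemeasurable
        (measurable_norm.comp (hQt p.1)).aestronglyMeasurable, ← integral_const_mul]
      simp [G]
    have h2 : 0 ≤ ∫ ω, |Q p.1 (g ω)| ∂P := integral_nonneg fun _ => abs_nonneg _
    rw [h1, Real.norm_eq_abs, abs_of_nonneg (mul_nonneg (abs_nonneg _) h2)]
    exact mul_le_mul hp.2 (hK _ hp.1) h2 hB
  constructor
  · rw [← hmap] at hGint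
    exact hGint.comp_measurable hfg
  · have h1 : ∫ ω, w ω * Q (σ ω) (g ω) ∂P = ∫ p, G p ∂(P.map (fun ω => ((σ ω, w ω), g ω))) :=
      (integral_map hfg.aemeasurable hG.aestronglyMeasurable).symm
    rw [h1, hmap, integral_prod _ hGint]
    have h2 : ∀ᵐ p ∂(P.map (fun ω => (σ ω, w ω))), ∫ a, G (p, a) ∂(P.map g) = c * p.2 :=
      hae.mono fun p hp => by
        simp only [G]
        rw [integral_const_mul, integral_map hg.aemeasurable (hQt p.1).aestronglyMeasurable,
          hc _ hp.1, mul_comm]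
    rw [integral_congr_ae h2, integral_const_mul,
      integral_map hf.aemeasurable measurable_snd.aestronglyMeasurable]

/-- Right-continuous processes are jointly measurable. -/
lemma measurable_uncurry_of_rightContinuous {α : Type*} [MeasurableSpace α] {Q : ℝ≥0 → α → ℝ}
    (hQ : ∀ t, Measurable (Q t))
    (hr : ∀ a t, ContinuousWithinAt (fun s => Q s a) (Set.Ici t) t) :
    Measurable (Function.uncurry Q) := by
  -- The next grid point of mesh `1/(n+1)` to the right of `t`: it takes countably many values and
  -- converges to `t` from the right.
  let r : ℕ → ℝ≥0 → ℝ≥0 := fun n t => ((⌊t * (n + 1)⌋₊ + 1 : ℕ) : ℝ≥0) / (n + 1)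
  have hmeas : ∀ n, Measurable (fun p : ℝ≥0 × α => Q (r n p.1) p.2) := by
    intro n
    have h1 : Measurable (fun p : ℕ × α => Q (((p.1 + 1 : ℕ) : ℝ≥0) / (n + 1)) p.2) :=
      measurable_from_prod_countable_right fun k =>
        hQ (((k + 1 : ℕ) : ℝ≥0) / (n + 1))
    have h2 : Measurable (fun t : ℝ≥0 => ⌊t * (n + 1)⌋₊) :=
      Nat.measurable_floor.comp (measurable_id.mul_const _)
    exact h1.comp ((h2.comp measurable_fst).prodMk measurable_snd)
  refine measurable_of_tendsto_metrizable hmeas ?_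
  rw [tendsto_pi_nhds]
  rintro ⟨t, a⟩
  have hpos : ∀ n : ℕ, (0 : ℝ≥0) < n + 1 := fun n => by positivity
  have hge : ∀ n, t ≤ r n t := fun n => by
    rw [le_div_iff₀ (hpos n)]
    push_cast
    exact (Nat.lt_floor_add_one _).le
  have hle : ∀ n, r n t ≤ t + 1 / (n + 1) := fun n => by
    rw [div_le_iff₀ (hpos n), add_mul, div_mul_cancel₀ _ (hpos n).ne']
    push_cast
    gcongr
    exact Nat.floor_le zero_le
  have hlim : Tendsto (fun n => r n t) atTop (𝓝 t) := by
    refine tendsto_of_tendsto_of_tendsto_of_le_of_le tendsto_const_nhds ?_ hge hle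
    simpa using tendsto_const_nhds.add (tendsto_one_div_add_atTop_nhds_zero_nat (𝕜 := ℝ≥0))
  exact (hr a t).tendsto.comp (tendsto_nhdsWithin_iff.2 ⟨hlim, Eventually.of_forall hge⟩)

/-! ### Arrivals, sizes, and their independence from prices -/

namespace Model

variable {M : Model m} {θ : ℝ≥0}

/-- The Poisson law of the increment lives on the nonnegative integers. Monotonicity is not
automatic, since `ncard` drops to `0` when arrivals accumulate. -/
lemma IsPoissonDarkPool.N_le (hDP : M.IsPoissonDarkPool θ P) {s t : ℝ≥0} (hst : s ≤ t) :
    ∀ᵐ ω ∂P, M.N s ω ≤ M.N t ω := by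
  have hl := hDP.poisson.law s t hst
  have h : ∀ᵐ z ∂(P.map (fun ω => (M.N t ω : ℤ) - M.N s ω)), 0 ≤ z := by
    rw [hl.map_eq, ae_map_iff (measurable_of_countable _).aemeasurable (MeasurableSet.of_discrete)]
    exact Eventually.of_forall fun n => Int.natCast_nonneg n
  filter_upwards [ae_of_ae_map hl.aemeasurable h] with ω hω
  omega

/-- Accumulating arrivals would give `N = 0` at a large integer time, while `N = 1` between the
first two arrivals. Monotonicity along countably many pairs of times excludes this. -/
lemma IsPoissonDarkPool.ae_regularArrivals (hDP : M.IsPoissonDarkPool θ P) :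
    ∀ᵐ ω ∂P, M.RegularArrivals ω := by
  have h : ∀ᵐ ω ∂P, ∀ n k : ℕ, TopologicalSpace.denseSeq ℝ≥0 n ≤ k →
      M.N (TopologicalSpace.denseSeq ℝ≥0 n) ω ≤ M.N k ω := by
    simp_rw [ae_all_iff]
    exact fun n k hnk => hDP.N_le hnk
  filter_upwards [h, hDP.τ_pos, hDP.τ_strictMono] with ω h hpos hmono
  refine ⟨hpos, hmono, fun t => ?_⟩
  by_contra hinf
  obtain ⟨k, hk⟩ := exists_nat_ge t
  have hinfk : {i : ℕ | M.τ i ω ≤ k}.Infinite :=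
    Set.Infinite.mono (fun i (hi : M.τ i ω ≤ t) => hi.trans hk) hinf
  obtain ⟨i, hi, hi1⟩ := hinfk.exists_gt 1
  obtain ⟨_, ⟨n, rfl⟩, hq0, hq1⟩ := (TopologicalSpace.denseRange_denseSeq ℝ≥0).exists_between
    (hmono zero_lt_one)
  have h1 := h n k (hq1.le.trans ((hmono hi1).le.trans hi))
  have h2 : {i : ℕ | M.τ i ω ≤ TopologicalSpace.denseSeq ℝ≥0 n} = {0} := by
    ext j
    simp only [Set.mem_ofPred_eq, Set.mem_singleton_iff]
    constructor
    · intro hj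
      by_contra hj0
      have := hmono.monotone (Nat.one_le_iff_ne_zero.2 hj0)
      exact absurd (hq1.trans_le this) (not_lt.2 hj)
    · rintro rfl
      exact hq0.le
  simp [N, hinfk.ncard, h2] at h1

/-- Second Borel–Cantelli lemma: independent events with the same positive probability. -/
lemma IsPoissonDarkPool.ae_exists_large (hDP : M.IsPoissonDarkPool θ P) (x : ℝ) :
    ∀ᵐ ω ∂P, ∃ i, ENNReal.ofReal x ≤ M.size i ω := by
  have hms : ∀ i, MeasurableSet {ω | ENNReal.ofReal x ≤ M.size i ω} := fun i =>
    measurableSet_le measurable_const (M.measurable_size i)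
  have hind : iIndepSet (fun i => {ω | ENNReal.ofReal x ≤ M.size i ω}) P :=
    (iIndepSet_iff_meas_biInter hms).2 fun s =>
      hDP.size_iIndep.measure_inter_preimage_eq_mul s (sets := fun _ => Set.Ici (ENNReal.ofReal x))
        fun _ _ => measurableSet_Ici
  have heq : ∀ i, P {ω | ENNReal.ofReal x ≤ M.size i ω} = P {ω | ENNReal.ofReal x ≤ M.size 0 ω} :=
    fun i => (hDP.size_identDistrib i).measure_mem_eq (s := Set.Ici (ENNReal.ofReal x))
      measurableSet_Ici
  have hsum : ∑' i, P {ω | ENNReal.ofReal x ≤ M.size i ω} = ∞ := by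
    simp_rw [heq]
    exact ENNReal.tsum_const_eq_top_of_ne_zero (hDP.size_unbounded x.toNNReal).ne'
  have := measure_limsup_eq_one hms hind hsum
  have : IsProbabilityMeasure P := hind.isProbabilityMeasure
  have hlim : ∀ᵐ ω ∂P, ω ∈ limsup (fun i => {ω | ENNReal.ofReal x ≤ M.size i ω}) atTop :=
    (prob_compl_eq_zero_iff (MeasurableSet.measurableSet_limsup hms)).2 ‹_›
  filter_upwards [hlim] with ω hω
  exact (mem_limsup_iff_frequently_mem.1 hω).exists

variable (M) in
/-- The information about the arrival times and sizes of the matching orders. -/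
@[reducible]
noncomputable def darkInfo : MeasurableSpace Ω :=
  (⨆ t, MeasurableSpace.comap (M.N t) inferInstance) ⊔
    ⨆ i, MeasurableSpace.comap (M.size i) inferInstance

variable (M) in
/-- The information about the unaffected prices. -/
@[reducible]
def priceInfo : MeasurableSpace Ω :=
  ⨆ t, MeasurableSpace.comap (M.P0 t) inferInstance

lemma darkInfo_le : M.darkInfo ≤ m :=
  sup_le (iSup_le fun t => (M.measurable_N t).comap_le)
    (iSup_le fun i => (M.measurable_size i).comap_le)

lemma IsAlmgrenChriss.measurable_P0 (hAC : M.IsAlmgrenChriss P) (t : ℝ≥0) : Measurable (M.P0 t) :=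
  ((hAC.martingale.stronglyMeasurable t).mono (M.ℱ.le t)).measurable

lemma IsAlmgrenChriss.priceInfo_le (hAC : M.IsAlmgrenChriss P) : M.priceInfo ≤ m :=
  iSup_le fun t => (hAC.measurable_P0 t).comap_le

lemma indep_darkInfo_priceInfo (hAC : M.IsAlmgrenChriss P) (hDP : M.IsPoissonDarkPool θ P) :
    Indep M.darkInfo M.priceInfo P := by
  have h := indep_iSup_of_disjoint (S := {1, 2}) (T := {0}) (fun i => ?_) hDP.independent
    (by simp)
  · simpa [iSup_insert, iSup_singleton, darkInfo, priceInfo] using h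
  · fin_cases i
    · exact hAC.priceInfo_le
    · exact le_sup_left.trans M.darkInfo_le
    · exact le_sup_right.trans M.darkInfo_le

lemma measurableSet_hit (x : ℝ) (t : ℝ≥0) : MeasurableSet[M.darkInfo] (M.hit x t) := by
  have hN : Measurable[M.darkInfo] (M.N t) :=
    Measurable.mono (comap_measurable _)
      ((le_iSup (fun t => MeasurableSpace.comap (M.N t) inferInstance) t).trans le_sup_left) le_rfl
  have hs : ∀ i, Measurable[M.darkInfo] (M.size i) := fun i =>
    Measurable.mono (comap_measurable _)
      ((le_iSup (fun i => MeasurableSpace.comap (M.size i) inferInstance) i).trans le_sup_right)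
      le_rfl
  have : M.hit x t = ⋃ i, (M.N t ⁻¹' Set.Ioi i ∩ M.size i ⁻¹' Set.Ici (ENNReal.ofReal x)) := by
    ext ω
    simp [hit]
  rw [this]
  exact MeasurableSet.iUnion fun i =>
    (hN MeasurableSet.of_discrete).inter (hs i measurableSet_Ici)

/-- The infimum over a countable dense set of times makes this immediate, and measurability in
`darkInfo` is what yields independence from prices. -/
lemma measurable_hitTime (x : ℝ) (S : ℝ≥0) : Measurable[M.darkInfo] (M.hitTime x S) := by
  let _ := M.darkInfo
  exact Measurable.min measurable_const (Measurable.iInf fun n =>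
    (measurable_const.indicator (M.measurableSet_hit x _)).add
      (measurable_const.indicator (M.measurableSet_hit x _).compl))

/-- Conditional expectation contracts `L¹`; this supplies the uniform bound `K` on bounded time
intervals. -/
lemma IsAlmgrenChriss.integral_abs_P0_le (hAC : M.IsAlmgrenChriss P) {s t : ℝ≥0} (hst : s ≤ t) :
    ∫ ω, |M.P0 s ω| ∂P ≤ ∫ ω, |M.P0 t ω| ∂P := by
  have h : ∫ ω, |M.P0 s ω| ∂P = ∫ ω, |(P[M.P0 t | M.ℱ s]) ω| ∂P :=
    integral_congr_ae ((hAC.martingale.condExp_ae_eq hst).symm.fun_comp (fun x => |x|))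
  exact h.le.trans (integral_abs_condExp_le _)

lemma IsAlmgrenChriss.integral_P0 [IsProbabilityMeasure P] (hAC : M.IsAlmgrenChriss P) (t : ℝ≥0) :
    ∫ ω, M.P0 t ω ∂P = ∫ ω, M.P0 0 ω ∂P := by
  have := hAC.martingale.setIntegral_eq (zero_le : 0 ≤ t) MeasurableSet.univ
  simpa using this.symm

lemma measurable_uncurry_P0 (hAC : M.IsAlmgrenChriss P) :
    Measurable[MeasurableSpace.prod inferInstance M.priceInfo] (Function.uncurry M.P0) := by
  let _ := M.priceInfo
  refine measurable_uncurry_of_rightContinuous (fun t => ?_) fun ω t => (hAC.cadlag ω t).1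
  exact Measurable.mono (comap_measurable _)
    (le_iSup (fun t => MeasurableSpace.comap (M.P0 t) inferInstance) t) le_rfl

variable [IsProbabilityMeasure P]

/-- The price at a random time which depends on the dark pool only. -/
lemma integral_mul_P0 (hAC : M.IsAlmgrenChriss P) (hDP : M.IsPoissonDarkPool θ P) {T : ℝ≥0}
    {σ : Ω → ℝ≥0} {w : Ω → ℝ} {B : ℝ} (hσm : Measurable[M.darkInfo] σ)
    (hwm : Measurable[M.darkInfo] w) (hσ : ∀ ω, σ ω ≤ T) (hw : ∀ ω, |w ω| ≤ B) :
    Integrable (fun ω => w ω * M.P0 (σ ω) ω) P ∧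
      ∫ ω, w ω * M.P0 (σ ω) ω ∂P = (∫ ω, M.P0 0 ω ∂P) * ∫ ω, w ω ∂P := by
  -- The independent object `g` is the identity into `Ω` with the coarser σ-algebra `priceInfo`,
  -- which carries the whole price path.
  refine @integral_mul_eval_of_indepFun Ω m P _ Ω M.priceInfo id
    (measurable_id'' hAC.priceInfo_le) M.P0 (measurable_uncurry_P0 hAC) T
    (∫ ω, |M.P0 T ω| ∂P) B _ (fun t _ => hAC.martingale.integrable t)
    (fun t ht => hAC.integral_abs_P0_le ht) (fun t _ => hAC.integral_P0 t) σ w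
    (hσm.mono M.darkInfo_le le_rfl) (hwm.mono M.darkInfo_le le_rfl) hσ hw ?_
  rw [@IndepFun_iff_Indep _ _ _ _ _ M.priceInfo]
  refine indep_of_indep_of_le_left ?_ (Measurable.comap_le (hσm.prodMk hwm))
  rw [MeasurableSpace.comap_id]
  exact indep_darkInfo_priceInfo hAC hDP

/-- Joint integrability of the prices on a time interval, with a weight which depends on the dark
pool only. -/
lemma integrable_prod_mul_P0 (hAC : M.IsAlmgrenChriss P)
    (hDP : M.IsPoissonDarkPool θ P) (S T : ℝ≥0)
    {w : Ω → ℝ} {B : ℝ} (hwm : Measurable[M.darkInfo] w) (hw : ∀ ω, |w ω| ≤ B) :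
    Integrable (fun p : ℝ × Ω => w p.2 * M.P0 p.1.toNNReal p.2)
      ((volume.restrict (Set.Ioc (S : ℝ) T)).prod P) := by
  have hB : 0 ≤ B := by
    obtain ⟨ω⟩ := nonempty_of_isProbabilityMeasure P
    exact (abs_nonneg _).trans (hw ω)
  have hm : Measurable (fun p : ℝ × Ω => w p.2 * M.P0 p.1.toNNReal p.2) := by
    have h : Measurable (Function.uncurry M.P0) :=
      measurable_uncurry_of_rightContinuous hAC.measurable_P0 fun ω t => (hAC.cadlag ω t).1
    exact ((hwm.mono M.darkInfo_le le_rfl).comp measurable_snd).mul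
      (h.comp (measurable_fst.real_toNNReal.prodMk measurable_snd))
  have hint : ∀ t : ℝ, Integrable (fun ω => w ω * M.P0 t.toNNReal ω) P := fun t =>
    (integral_mul_P0 hAC hDP (σ := fun _ => t.toNNReal) measurable_const hwm (fun _ => le_rfl)
      hw).1
  rw [integrable_prod_iff hm.aestronglyMeasurable]
  refine ⟨Eventually.of_forall hint, ?_⟩
  refine Integrable.of_bound (C := B * ∫ ω, |M.P0 T ω| ∂P)
    hm.aestronglyMeasurable.norm.integral_prod_right'
    ((ae_restrict_mem measurableSet_Ioc).mono fun t ht => ?_)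
  rw [Real.norm_of_nonneg (integral_nonneg fun _ => norm_nonneg _)]
  calc ∫ ω, ‖w ω * M.P0 t.toNNReal ω‖ ∂P
      ≤ ∫ ω, B * |M.P0 t.toNNReal ω| ∂P := by
        refine integral_mono (hint t).norm
          ((hAC.martingale.integrable _).abs.const_mul _) fun ω => ?_
        simp only [norm_mul, Real.norm_eq_abs]
        exact mul_le_mul_of_nonneg_right (hw ω) (abs_nonneg _)
    _ = B * ∫ ω, |M.P0 t.toNNReal ω| ∂P := integral_const_mul _ _
    _ ≤ _ := mul_le_mul_of_nonneg_left
        (hAC.integral_abs_P0_le (Real.toNNReal_le_iff_le_coe.2 ht.2)) hB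

lemma ae_intervalIntegrable_P0 (hAC : M.IsAlmgrenChriss P) (hDP : M.IsPoissonDarkPool θ P)
    {S T : ℝ≥0} (hST : S ≤ T) :
    ∀ᵐ ω ∂P, IntervalIntegrable (fun t : ℝ => M.P0 t.toNNReal ω) volume S T := by
  have hint := integrable_prod_mul_P0 hAC hDP S T (w := fun _ => 1) measurable_const
    fun _ => abs_one.le
  filter_upwards [hint.prod_left_ae] with ω hω
  rw [intervalIntegrable_iff_integrableOn_Ioc_of_le (by exact_mod_cast hST)]
  simpa [IntegrableOn] using hω

/-- The price averaged over a time interval, with a weight which depends on the dark pool only. -/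
lemma integral_mul_intervalIntegral_P0 (hAC : M.IsAlmgrenChriss P)
    (hDP : M.IsPoissonDarkPool θ P) {S T : ℝ≥0} (hST : S ≤ T)
    {w : Ω → ℝ} {B : ℝ} (hwm : Measurable[M.darkInfo] w) (hw : ∀ ω, |w ω| ≤ B) :
    Integrable (fun ω => w ω * ∫ t in (S : ℝ)..T, M.P0 t.toNNReal ω) P ∧
      ∫ ω, w ω * (∫ t in (S : ℝ)..T, M.P0 t.toNNReal ω) ∂P =
        (T - S) * ((∫ ω, M.P0 0 ω ∂P) * ∫ ω, w ω ∂P) := by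
  have hST' : (S : ℝ) ≤ T := by exact_mod_cast hST
  have hint := integrable_prod_mul_P0 hAC hDP S T hwm hw
  simp_rw [intervalIntegral.integral_of_le hST', ← integral_const_mul]
  refine ⟨hint.integral_prod_right, ?_⟩
  rw [← integral_integral_swap hint]
  simp_rw [fun t : ℝ => (integral_mul_P0 hAC hDP (σ := fun _ => t.toNNReal) measurable_const hwm
    (fun _ => le_rfl) hw).2]
  simp [hST', integral_const_mul]

end Model

end DarkPool

/-! ### The waiting strategy: admissibility and pathwise costs -/

namespace DarkPool

lemma intervalIntegral_eq_of_zero_before {f g : ℝ → ℝ} {a b c : ℝ} (hab : a ≤ b) (hbc : b ≤ c)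
    (h0 : ∀ t ∈ Set.Ioc a b, f t = 0) (hfg : ∀ t ∈ Set.Ioc b c, f t = g t)
    (hg : IntervalIntegrable g volume b c) :
    IntervalIntegrable f volume a c ∧ ∫ t in a..c, f t = ∫ t in b..c, g t := by
  have h1 : Set.EqOn (fun _ => (0 : ℝ)) f (Set.uIoc a b) := fun t ht =>
    (h0 t (by rwa [Set.uIoc_of_le hab] at ht)).symm
  have h2 : Set.EqOn g f (Set.uIoc b c) := fun t ht =>
    (hfg t (by rwa [Set.uIoc_of_le hbc] at ht)).symm
  have hf1 : IntervalIntegrable f volume a b := IntervalIntegrable.congr h1 (by simp)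
  have hf2 : IntervalIntegrable f volume b c := IntervalIntegrable.congr h2 hg
  refine ⟨hf1.trans hf2, ?_⟩
  rw [← intervalIntegral.integral_add_adjacent_intervals hf1 hf2,
    intervalIntegral.integral_congr_ae (g := fun _ => (0 : ℝ))
      (Eventually.of_forall fun t ht => (h1 ht).symm),
    intervalIntegral.integral_congr_ae (g := g) (Eventually.of_forall fun t ht => (h2 ht).symm)]
  simp

namespace Model

variable {Ω : Type*} {m : MeasurableSpace Ω} {P : Measure Ω} (M : Model m)

/-- Wait until time `S` for the execution of a dark-pool order of size `x`, then cancel it and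
liquidate at a constant rate until time `2S`. -/
noncomputable def waitStrategy (X₀ x : ℝ) (S : ℝ≥0) : Strategy Ω where
  X := x
  Ξ := x
  ξ t ω := if S < t then -(X₀ + M.Z x x S ω) / S else 0
  ρ _ := S

variable {M} {X₀ x : ℝ} {S : ℝ≥0} {ω : Ω}

lemma waitStrategy_ξ_of_le {t : ℝ≥0} (h : t ≤ S) : (M.waitStrategy X₀ x S).ξ t ω = 0 :=
  if_neg (not_lt.2 h)

lemma waitStrategy_ξ_of_lt {t : ℝ≥0} (h : S < t) :
    (M.waitStrategy X₀ x S).ξ t ω = -(X₀ + M.Z x x S ω) / S :=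
  if_pos h

lemma waitStrategy_ξ_toNNReal_of_mem_Ioc_zero {t : ℝ} (h : t ∈ Set.Ioc (0 : ℝ) S) :
    (M.waitStrategy X₀ x S).ξ t.toNNReal ω = 0 :=
  waitStrategy_ξ_of_le (Real.toNNReal_le_iff_le_coe.2 h.2)

lemma waitStrategy_ξ_toNNReal_of_lt {t : ℝ} (h : (S : ℝ) < t) :
    (M.waitStrategy X₀ x S).ξ t.toNNReal ω = -(X₀ + M.Z x x S ω) / S :=
  waitStrategy_ξ_of_lt (Real.lt_toNNReal_iff_coe_lt.2 h)

lemma waitStrategy_intervalIntegrable (T : ℝ≥0) :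
    IntervalIntegrable (fun s : ℝ => (M.waitStrategy X₀ x S).ξ s.toNNReal ω) volume 0 T := by
  rcases le_total S T with h | h
  · exact (intervalIntegral_eq_of_zero_before S.coe_nonneg (NNReal.coe_le_coe.2 h)
      (fun t ht => waitStrategy_ξ_toNNReal_of_mem_Ioc_zero ht)
      (fun t ht => waitStrategy_ξ_toNNReal_of_lt ht.1) intervalIntegrable_const).1
  · exact (intervalIntegral_eq_of_zero_before T.coe_nonneg le_rfl
      (fun t ht => waitStrategy_ξ_toNNReal_of_mem_Ioc_zero ⟨ht.1, ht.2.trans h⟩)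
      (g := 0) (by simp) (by simp)).1

lemma waitStrategy_traded_of_le {t : ℝ≥0} (h : t ≤ S) :
    (M.waitStrategy X₀ x S).traded t ω = 0 := by
  rw [Strategy.traded, (intervalIntegral_eq_of_zero_before t.coe_nonneg le_rfl
      (fun s hs => waitStrategy_ξ_toNNReal_of_mem_Ioc_zero ⟨hs.1, hs.2.trans h⟩)
      (g := 0) (by simp) (by simp)).2]
  simp

lemma waitStrategy_traded_of_ge {t : ℝ≥0} (h : S ≤ t) :
    (M.waitStrategy X₀ x S).traded t ω = (t - S) * (-(X₀ + M.Z x x S ω) / S) := by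
  rw [Strategy.traded, (intervalIntegral_eq_of_zero_before S.coe_nonneg (NNReal.coe_le_coe.2 h)
      (fun t ht => waitStrategy_ξ_toNNReal_of_mem_Ioc_zero ht)
      (fun t ht => waitStrategy_ξ_toNNReal_of_lt ht.1) intervalIntegrable_const).2,
    intervalIntegral.integral_const, smul_eq_mul]

lemma abs_Z_le (hx : 0 < x) (t : ℝ≥0) : |M.Z x x t ω| ≤ x := by
  rw [M.Z_self hx, ← Real.norm_eq_abs]
  exact (norm_indicator_le_norm_self _ _).trans (by simp [abs_of_pos hx])

lemma measurable_Z_𝒢 (M : Model m) (X Ξ : ℝ) (t : ℝ≥0) : Measurable[M.𝒢 X Ξ t] (M.Z X Ξ t) := by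
  have h : Filtration.natural (M.Z X Ξ) (fun t => (M.measurable_Z X Ξ t).stronglyMeasurable)
      ≤ M.𝒢 X Ξ :=
    (le_sup_right.trans le_sup_left).trans (Filtration.le_rightCont _)
  refine Measurable.mono ?_ (h t) le_rfl
  exact Measurable.mono (comap_measurable _)
    (le_iSup₂_of_le (f := fun s (_ : s ≤ t) => MeasurableSpace.comap (M.Z X Ξ s) _) t le_rfl le_rfl)
    le_rfl

/-- The speed takes one constant value on each of two predictable rectangles `(S, ∞) × A` with `A ∈
𝒢_S`, and vanishes elsewhere. -/
lemma waitStrategy_predictable (M : Model m) (X₀ : ℝ) (hx : 0 < x) (S : ℝ≥0) :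
    IsStronglyPredictable (M.𝒢 x x) (M.waitStrategy X₀ x S).ξ := by
  have hhit : MeasurableSet[M.𝒢 x x S] (M.hit x S) := by
    have h := M.measurable_Z_𝒢 x x S (measurableSet_singleton x)
    convert h using 1
    ext ω
    by_cases hω : ω ∈ M.hit x S <;> simp [M.Z_self hx, hω, hx.ne]
  let _ := (M.𝒢 x x).predictable
  have h1 := measurableSet_predictable_Ioi_prod (i := S) hhit
  have h2 := measurableSet_predictable_Ioi_prod (i := S) hhit.compl
  have h : Measurable (Function.uncurry (M.waitStrategy X₀ x S).ξ) := by
    have h3 : Function.uncurry (M.waitStrategy X₀ x S).ξ =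
        fun p => (Set.Ioi S ×ˢ M.hit x S).indicator (fun _ => -(X₀ + x) / S) p +
          (Set.Ioi S ×ˢ (M.hit x S)ᶜ).indicator (fun _ => -X₀ / S) p := by
      ext ⟨t, ω⟩
      by_cases ht : S < t <;> by_cases hω : ω ∈ M.hit x S <;>
        simp [waitStrategy, M.Z_self hx, ht, hω]
    rw [h3]
    exact (measurable_const.indicator h1).add (measurable_const.indicator h2)
  exact h.stronglyMeasurable

lemma waitStrategy_mem_admissible [IsProbabilityMeasure P] (M : Model m) (X₀ : ℝ) (hx : 0 < x)
    (hS : 0 < S) : M.waitStrategy X₀ x S ∈ M.admissible P X₀ (S + S) := by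
  have hS' : (S : ℝ) ≠ 0 := by exact_mod_cast hS.ne'
  have htraded : ∀ ω, (M.waitStrategy X₀ x S).traded (S + S) ω = -(X₀ + M.Z x x S ω) := fun ω => by
    rw [waitStrategy_traded_of_ge le_self_add]
    push_cast
    field_simp
    ring
  refine ⟨⟨hx.le, le_abs_self x⟩, isStoppingTime_const _ _,
    Eventually.of_forall fun ω => lt_add_of_pos_right _ hS, M.waitStrategy_predictable X₀ hx S,
    Eventually.of_forall fun ω => waitStrategy_intervalIntegrable _,
    ⟨|X₀| + x, Eventually.of_forall fun ω t ht => ?_⟩, Eventually.of_forall fun ω => ?_⟩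
  · rcases le_total t S with h | h
    · rw [waitStrategy_traded_of_le h, abs_zero]
      positivity
    · have h1 : (S : ℝ) ≤ t := h
      have h2 : (t : ℝ) ≤ S + S := by exact_mod_cast ht
      have hSpos : (0 : ℝ) < S := hS
      rw [waitStrategy_traded_of_ge h, abs_mul, abs_div, abs_neg, abs_of_nonneg (sub_nonneg.2 h1),
        abs_of_pos hSpos]
      calc ((t : ℝ) - S) * (|X₀ + M.Z x x S ω| / S)
          ≤ S * (|X₀ + M.Z x x S ω| / S) := by
            gcongr
            linarith
        _ = |X₀ + M.Z x x S ω| := by field_simp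
        _ ≤ _ := (abs_add_le _ _).trans (by gcongr; exact abs_Z_le hx S)
  · rw [htraded]
    simp only [waitStrategy]
    ring

/-- The executions in the dark pool take place at the unaffected price. -/
lemma RegularArrivals.sum_Y_mul (hω : M.RegularArrivals ω) (hx : 0 < x) (h0 : M.h 0 = 0)
    (hβ : ∀ y, M.β y = 0) :
    ∑ i ∈ Finset.range (M.N S ω), M.Y x x i ω *
      (M.darkPrice (M.waitStrategy X₀ x S) (M.τ i ω) ω
        + M.α * M.γ * Function.leftLim (fun t => M.Z x x t ω) (M.τ i ω) + M.β (M.Y x x i ω)) =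
      M.Z x x S ω * M.P0 (M.hitTime x S ω) ω := by
  rw [Z, Finset.sum_mul]
  refine Finset.sum_congr rfl fun i hi => ?_
  by_cases hY : M.Y x x i ω = 0
  · simp [hY]
  · have hτ : M.τ i ω ≤ S := hω.lt_N_iff.1 (Finset.mem_range.1 hi)
    rw [hω.hitTime_eq hx hY hτ, hω.leftLim_Z hx hY, darkPrice, waitStrategy_traded_of_le hτ,
      waitStrategy_ξ_of_le hτ, h0, hβ]
    simp

variable (M X₀ x S ω) in
/-- The costs of `waitStrategy`, up to a null set. -/
noncomputable def waitCosts : ℝ :=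
  X₀ * M.P0 0 ω
    + (-(X₀ + M.Z x x S ω) / S) * (∫ t in (S : ℝ)..(S + S : ℝ≥0), M.P0 t.toNNReal ω)
    + M.γ / 2 * (X₀ ^ 2 - M.Z x x S ω ^ 2)
    + -(X₀ + M.Z x x S ω) * M.h (-(X₀ + M.Z x x S ω) / S)
    + M.Z x x S ω * M.P0 (M.hitTime x S ω) ω

lemma RegularArrivals.costs_waitStrategy (hω : M.RegularArrivals ω) (hx : 0 < x) (hS : 0 < S)
    (h0 : M.h 0 = 0) (hβ : ∀ y, M.β y = 0) (hα : M.α = 1)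
    (hP0 : IntervalIntegrable (fun t : ℝ => M.P0 t.toNNReal ω) volume S (S + S : ℝ≥0)) :
    M.costs X₀ (S + S) (M.waitStrategy X₀ x S) ω = M.waitCosts X₀ x S ω := by
  have hS' : (S : ℝ) ≠ 0 := by exact_mod_cast hS.ne'
  have hle : (S : ℝ) ≤ (S + S : ℝ≥0) := by exact_mod_cast le_self_add
  set z := M.Z x x S ω with hz
  set v := -(X₀ + z) / S with hv
  set χ := M.waitStrategy X₀ x S with hχ
  have hlin : IntervalIntegrable (fun t : ℝ => M.γ * v ^ 2 * (t - S) + v * M.h v) volume S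
      (S + S : ℝ≥0) := (by fun_prop : Continuous _).intervalIntegrable _ _
  obtain ⟨hi1, he1⟩ := intervalIntegral_eq_of_zero_before
    (f := fun t : ℝ => χ.ξ t.toNNReal ω * M.price χ t.toNNReal ω)
    (g := fun t => v * M.P0 t.toNNReal ω + (M.γ * v ^ 2 * (t - S) + v * M.h v))
    S.coe_nonneg hle
    (fun t ht => by simp only [hχ, waitStrategy_ξ_toNNReal_of_mem_Ioc_zero ht, zero_mul])
    (fun t ht => by
      have h1 : S ≤ t.toNNReal := (Real.lt_toNNReal_iff_coe_lt.2 ht.1).le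
      have h2 : ((t.toNNReal : ℝ≥0) : ℝ) = t := Real.coe_toNNReal _ (S.coe_nonneg.trans ht.1.le)
      simp only [price, hχ, waitStrategy_ξ_toNNReal_of_lt ht.1, waitStrategy_traded_of_ge h1, h2]
      ring)
    ((hP0.const_mul v).add hlin)
  obtain ⟨-, he2⟩ := intervalIntegral_eq_of_zero_before
    (f := fun t : ℝ => M.Z x x (min S t.toNNReal) ω * χ.ξ t.toNNReal ω)
    (g := fun _ => z * v) S.coe_nonneg hle
    (fun t ht => by simp only [hχ, waitStrategy_ξ_toNNReal_of_mem_Ioc_zero ht, mul_zero])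
    (fun t ht => by
      have h1 : S ≤ t.toNNReal := (Real.lt_toNNReal_iff_coe_lt.2 ht.1).le
      simp only [hχ, waitStrategy_ξ_toNNReal_of_lt ht.1, min_eq_left h1]
      rfl)
    intervalIntegrable_const
  have hint : ∫ t in (S : ℝ)..(S + S : ℝ≥0), (M.γ * v ^ 2 * (t - S) + v * M.h v)
      = M.γ * v ^ 2 * (S ^ 2 / 2) + S * (v * M.h v) := by
    rw [intervalIntegral.integral_add ((by fun_prop : Continuous _).intervalIntegrable _ _)
      intervalIntegrable_const, intervalIntegral.integral_const_mul,
      intervalIntegral.integral_comp_sub_right (fun t => t), integral_id]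
    simp
    ring
  rw [costs, if_pos hi1, he1, intervalIntegral.integral_add (hP0.const_mul v) hlin, hint,
    intervalIntegral.integral_const_mul]
  have hsum := hω.sum_Y_mul (X₀ := X₀) (S := S) hx h0 hβ
  rw [← hz] at hsum
  have hsv : (S : ℝ) * v = -(X₀ + z) := by rw [hv]; field_simp
  congr 1
  unfold waitCosts
  rw [← hz, ← hv]
  change X₀ * M.P0 0 ω + _ + M.α * M.γ * (∫ t in (0 : ℝ)..(S + S : ℝ≥0),
    M.Z x x (min S t.toNNReal) ω * χ.ξ t.toNNReal ω) + _ = _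
  rw [he2]
  erw [hsum]
  rw [hα, intervalIntegral.integral_const, ← hsv]
  simp only [NNReal.coe_add, add_sub_cancel_left, smul_eq_mul]
  -- Eliminating `z` removes the division by `S`, so both sides become polynomial in `v` and `S`.
  have hz' : z = -(S * v) - X₀ := by rw [hsv]; ring
  rw [hz']
  ring

/-! ### Expected costs and the long-horizon limit -/

variable {θ : ℝ≥0} [IsProbabilityMeasure P]

/-- The three price terms have means `E[P⁰_0]` times `X₀`, `-(X₀ + E[Z_S])` and `E[Z_S]`, which
cancel. The assumption `hh` bounds the temporary impact by the summand `1`. -/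
lemma expectation_costs_waitStrategy_le (hAC : M.IsAlmgrenChriss P)
    (hDP : M.IsPoissonDarkPool θ P) (hα : M.α = 1) (X₀ : ℝ) (hx : 0 < x) (hS : 0 < S)
    (hh : ∀ v, |v| ≤ (|X₀| + x) / S → (|X₀| + x) * |M.h v| ≤ 1) :
    expectation P (M.costs X₀ (S + S) (M.waitStrategy X₀ x S)) ≤
      ((M.γ / 2 * (X₀ ^ 2 - ∫ ω, M.Z x x S ω ^ 2 ∂P) + 1 : ℝ) : EReal) := by
  have hSpos : (0 : ℝ) < S := hS
  have hzm : Measurable[M.darkInfo] (M.Z x x S) := by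
    let _ := M.darkInfo
    rw [M.Z_self hx]
    exact measurable_const.indicator (M.measurableSet_hit x S)
  have hzm' : Measurable (M.Z x x S) := M.measurable_Z x x S
  have hzb : ∀ ω, |M.Z x x S ω| ≤ x := fun ω => abs_Z_le hx S
  have hab : ∀ ω, |X₀ + M.Z x x S ω| ≤ |X₀| + x := fun ω =>
    (abs_add_le _ _).trans (by gcongr; exact hzb ω)
  have hwm : Measurable[M.darkInfo] (fun ω => -(X₀ + M.Z x x S ω) / S) :=
    ((hzm.const_add X₀).neg).div_const _
  have hwb : ∀ ω, |-(X₀ + M.Z x x S ω) / S| ≤ (|X₀| + x) / S := fun ω => by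
    rw [abs_div, abs_neg, abs_of_pos hSpos]
    gcongr
    exact hab ω
  have hzint : Integrable (M.Z x x S) P :=
    Integrable.of_bound hzm'.aestronglyMeasurable x (Eventually.of_forall hzb)
  have hz2int : Integrable (fun ω => M.Z x x S ω ^ 2) P :=
    Integrable.of_bound (hzm'.pow_const 2).aestronglyMeasurable (x ^ 2)
      (Eventually.of_forall fun ω => by
        rw [norm_pow]
        exact pow_le_pow_left₀ (norm_nonneg _) (hzb ω) 2)
  have hhb : ∀ ω, |-(X₀ + M.Z x x S ω) * M.h (-(X₀ + M.Z x x S ω) / S)| ≤ 1 := fun ω => by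
    rw [abs_mul, abs_neg]
    exact (mul_le_mul_of_nonneg_right (hab ω) (abs_nonneg _)).trans (hh _ (hwb ω))
  have hhint : Integrable (fun ω => -(X₀ + M.Z x x S ω) * M.h (-(X₀ + M.Z x x S ω) / S)) P :=
    Integrable.of_bound ((hzm'.const_add X₀).neg.mul (hAC.impact.continuous.measurable.comp
      ((hzm'.const_add X₀).neg.div_const _))).aestronglyMeasurable 1 (Eventually.of_forall hhb)
  obtain ⟨hi1, he1⟩ := integral_mul_intervalIntegral_P0 hAC hDP
    (le_self_add : S ≤ S + S) hwm hwb
  obtain ⟨hi2, he2⟩ := integral_mul_P0 hAC hDP (M.measurable_hitTime x S) hzm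
    (T := S) (fun ω => min_le_left _ _) hzb
  have hi0 := (hAC.martingale.integrable 0).const_mul X₀
  have hi3 : Integrable (fun ω => M.γ / 2 * (X₀ ^ 2 - M.Z x x S ω ^ 2)) P :=
    ((integrable_const _).sub hz2int).const_mul _
  have hcosts : ∀ᵐ ω ∂P, M.costs X₀ (S + S) (M.waitStrategy X₀ x S) ω =
      M.waitCosts X₀ x S ω := by
    filter_upwards [hDP.ae_regularArrivals, ae_intervalIntegrable_P0 hAC hDP
      (le_self_add : S ≤ S + S)] with ω hω hP0
    exact hω.costs_waitStrategy hx hS hAC.impact.map_zero hDP.no_slippage hα hP0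
  have hsum : ∫ ω, M.waitCosts X₀ x S ω ∂P =
      (∫ ω, X₀ * M.P0 0 ω ∂P)
        + (∫ ω, -(X₀ + M.Z x x S ω) / S *
            (∫ t in (S : ℝ)..(S + S : ℝ≥0), M.P0 t.toNNReal ω) ∂P)
        + (∫ ω, M.γ / 2 * (X₀ ^ 2 - M.Z x x S ω ^ 2) ∂P)
        + (∫ ω, -(X₀ + M.Z x x S ω) * M.h (-(X₀ + M.Z x x S ω) / S) ∂P)
        + (∫ ω, M.Z x x S ω * M.P0 (M.hitTime x S ω) ω ∂P) := by
    refine (integral_add (((hi0.add hi1).add hi3).add hhint) hi2).trans (congrArg (· + _) ?_)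
    refine (integral_add ((hi0.add hi1).add hi3) hhint).trans (congrArg (· + _) ?_)
    exact (integral_add (hi0.add hi1) hi3).trans (congrArg (· + _) (integral_add hi0 hi1))
  rw [expectation_eq_integral hcosts ((((hi0.add hi1).add hi3).add hhint).add hi2), hsum,
    he1, he2, integral_const_mul, integral_const_mul,
    integral_sub (integrable_const _) hz2int, integral_div, integral_neg,
    integral_add (integrable_const _) hzint]
  simp only [integral_const, probReal_univ, one_smul, NNReal.coe_add, add_sub_cancel_left]
  have hle : ∫ ω, -(X₀ + M.Z x x S ω) * M.h (-(X₀ + M.Z x x S ω) / S) ∂P ≤ 1 := by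
    have := integral_mono hhint (integrable_const 1) fun ω => (le_abs_self _).trans (hhb ω)
    simpa using this
  rw [EReal.coe_le_coe_iff, ← mul_assoc, mul_comm (S : ℝ), mul_assoc,
    mul_div_cancel₀ _ hSpos.ne']
  linarith

/-- Almost surely some order of size at least `x` arrives at a finite time, after which `Z = x`;
dominated convergence does the rest. -/
lemma tendsto_integral_Z_sq (hDP : M.IsPoissonDarkPool θ P) (hx : 0 < x) :
    Tendsto (fun S => ∫ ω, M.Z x x S ω ^ 2 ∂P) atTop (𝓝 (x ^ 2)) := by
  have h : Tendsto (fun S => ∫ ω, M.Z x x S ω ^ 2 ∂P) atTop (𝓝 (∫ _, x ^ 2 ∂P)) := by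
    refine tendsto_integral_filter_of_dominated_convergence (fun _ => x ^ 2)
      (Eventually.of_forall fun S => ((M.measurable_Z x x S).pow_const 2).aestronglyMeasurable)
      (Eventually.of_forall fun S => Eventually.of_forall fun ω => ?_) (integrable_const _) ?_
    · rw [norm_pow]
      exact pow_le_pow_left₀ (norm_nonneg _) (abs_Z_le hx S) 2
    · filter_upwards [hDP.ae_regularArrivals, hDP.ae_exists_large x] with ω hω ⟨i, hi⟩
      refine tendsto_const_nhds.congr' ?_
      filter_upwards [eventually_ge_atTop (M.τ i ω)] with S hS
      rw [M.Z_self hx, Set.indicator_of_mem (hω.mem_hit_iff.2 ⟨i, hS, hi⟩)]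
  simpa using h

/-- Expected costs below any given level are attained on every sufficiently long horizon. -/
lemma eventually_exists_expectation_lt (hAC : M.IsAlmgrenChriss P)
    (hDP : M.IsPoissonDarkPool θ P) (hα : M.α = 1) (X₀ b : ℝ) :
    ∀ᶠ T : ℝ≥0 in atTop, ∃ χ ∈ M.admissible P X₀ T, expectation P (M.costs X₀ T χ) < b := by
  have hγ := hAC.γ_pos
  -- The order size is fixed first, from the limiting bound; only then is `S` taken large, depending
  -- on `x`.
  obtain ⟨x, hx, hxb⟩ : ∃ x : ℝ, 0 < x ∧ M.γ / 2 * (X₀ ^ 2 - x ^ 2) + 1 < b := by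
    have h : Tendsto (fun x : ℝ => M.γ / 2 * (X₀ ^ 2 - x ^ 2) + 1) atTop atBot := by
      refine tendsto_atBot_add_const_right _ _ (Tendsto.const_mul_atBot (by positivity) ?_)
      simp_rw [sub_eq_add_neg]
      exact tendsto_atBot_add_const_left _ _
        (tendsto_neg_atTop_atBot.comp (tendsto_pow_atTop two_ne_zero))
    exact ((eventually_gt_atTop 0).and (h.eventually_lt_atBot b)).exists
  have hR : 0 < |X₀| + x := by positivity
  have hcont : ∀ᶠ v in 𝓝 0, (|X₀| + x) * |M.h v| < 1 := by
    have : Continuous fun v => (|X₀| + x) * |M.h v| :=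
      continuous_const.mul hAC.impact.continuous.abs
    exact this.continuousAt.eventually_lt continuousAt_const (by simp [hAC.impact.map_zero])
  obtain ⟨δ, hδ, hδh⟩ := Metric.eventually_nhds_iff.1 hcont
  have hlim : Tendsto (fun S => M.γ / 2 * (X₀ ^ 2 - ∫ ω, M.Z x x S ω ^ 2 ∂P) + 1) atTop
      (𝓝 (M.γ / 2 * (X₀ ^ 2 - x ^ 2) + 1)) :=
    ((tendsto_const_nhds.sub (tendsto_integral_Z_sq hDP hx)).const_mul _).add_const _
  have hsmall : ∀ᶠ S : ℝ≥0 in atTop, (|X₀| + x) / S < δ :=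
    (Tendsto.const_div_atTop (NNReal.tendsto_coe_atTop.2 tendsto_id) _).eventually_lt_const hδ
  have hev := ((hlim.eventually_lt_const hxb).and hsmall).and (eventually_gt_atTop 0)
  -- The horizon `T` is split into equal waiting and liquidation periods, `S = T / 2`.
  have hhalf : Tendsto (fun T : ℝ≥0 => T / 2) atTop atTop := tendsto_id.atTop_div_const two_pos
  filter_upwards [hhalf.eventually hev] with T hT
  obtain ⟨⟨h1, h2⟩, h3⟩ := hT
  have hmem := M.waitStrategy_mem_admissible (P := P) X₀ hx h3
  have hle := expectation_costs_waitStrategy_le hAC hDP hα X₀ hx h3 fun v hv =>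
    (hδh (by simpa using hv.trans_lt h2)).le
  rw [add_halves] at hmem hle
  exact ⟨_, hmem, hle.trans_lt (EReal.coe_lt_coe_iff.2 h1)⟩

end Model

end DarkPool

theorem mainTheorem5 {Ω : Type*} {m : MeasurableSpace Ω} (P : MeasureTheory.Measure Ω)
    [MeasureTheory.IsProbabilityMeasure P] (M : DarkPool.Model m) (θ : ℝ≥0)
    (hAC : M.IsAlmgrenChriss P) (hDP : M.IsPoissonDarkPool θ P) (hα : M.α = 1) :
    (∀ X₀ : ℝ, Tendsto
      (fun T : ℝ≥0 => ⨅ χ ∈ M.admissible P X₀ T, DarkPool.expectation P (M.costs X₀ T χ))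
      atTop (𝓝 ⊥)) ∧
    ¬ M.NonnegativeExpectedLiquidationCosts P := by
  constructor
  · intro X₀
    rw [EReal.tendsto_nhds_bot_iff_real]
    intro b
    filter_upwards [DarkPool.Model.eventually_exists_expectation_lt hAC hDP hα X₀ b]
      with T ⟨χ, hχ, hlt⟩
    exact (iInf₂_le χ hχ).trans_lt hlt
  · intro hnn
    obtain ⟨T, ⟨χ, hχ, hlt⟩, hT⟩ :=
      ((DarkPool.Model.eventually_exists_expectation_lt hAC hDP hα 0 0).and
        (eventually_gt_atTop 0)).exists
    exact absurd hlt (not_lt.2 (hnn 0 T hT χ hχ))
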